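/- Let $\mathbb{K}$ be a field of characteristic zero, let $M$ be a connected CW-complex with finite $1$-skeleton, and let $p\colon F\to M$ be a connected Galois cover with finite Galois group $C$. For a space $X$ and $\alpha\in H^1(X,\mathbb{K})$, let $\mu_\alpha\colon H^{i}(X,\mathbb{K})\to H^{i+1}(X,\mathbb{K})$, $x\mapsto x\cup\alpha$, be right multiplication by $\alpha$ in the cohomology ring of $X$, and for $i\ge 0$ and $m>0$ let $$\mathcal{R}^i_m(X,\mathbb{K})=\{\alpha\in H^1(X,\mathbb{K}) \mid \dim_{\mathbb{K}} H^i(H^{\bullet}(X,\mathbb{K}),\mu_\alpha)\ge m\}$$ be the resonance varieties of $X$. Let $q\ge 1$ and suppose that $C$ acts trivially on $H^i(F,\mathbb{K})$ for all $i\le q$. Then $p^*\colon H^i(M,\mathbb{K})\to H^i(F,\mathbb{K})$ is an isomorphism for all $i\le q$ and a monomorphism for $i=q+1$. Moreover, the isomorphism $p^*\colon H^1(M,\mathbb{K})\to H^1(F,\mathbb{K})$ identifies the resonance varieties, that is, $p^*(\mathcal{R}^i_m(M,\mathbb{K}))=\mathcal{R}^i_m(F,\mathbb{K})$, for all $i\le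 q$ and all $m>0$. -/

import Mathlib

noncomputable section

/-- The image of the incoming map `A (n-1) → A n` of a sequence of linear maps
`A 0 → A 1 → A 2 → ⋯`, with `A (-1) = 0`. -/
def gradedBoundaries (K : Type*) [Field K] (A : ℕ → Type*) [∀ n, AddCommGroup (A n)]
    [∀ n, Module K (A n)] (d : ∀ n, A n →ₗ[K] A (n + 1)) : (n : ℕ) → Submodule K (A n)
  | 0 => ⊥
  | n + 1 => LinearMap.range (d n)

/-- The degree `n` cohomology `ker (A n → A (n+1)) / im (A (n-1) → A n)` of a cochain complex
`A 0 → A 1 → A 2 → ⋯`, with `A (-1) = 0`. -/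
abbrev GradedCohomology (K : Type*) [Field K] (A : ℕ → Type*) [∀ n, AddCommGroup (A n)]
    [∀ n, Module K (A n)] (d : ∀ n, A n →ₗ[K] A (n + 1)) (n : ℕ) :=
  LinearMap.ker (d n) ⧸ (gradedBoundaries K A d n).submoduleOf (LinearMap.ker (d n))

/-- Singular `n`-simplices of a topological space. -/
abbrev SingularSimplex (X : Type*) [TopologicalSpace X] (n : ℕ) :=
  C(stdSimplex ℝ (Fin (n + 1)), X)

/-- Precomposition of a singular simplex with the affine map of standard simplices that is given
on vertices by `θ`. -/
def SingularSimplex.reindex {X : Type*} [TopologicalSpace X] {m n : ℕ}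
    (σ : SingularSimplex X n) (θ : Fin (m + 1) → Fin (n + 1)) : SingularSimplex X m :=
  σ.comp ⟨stdSimplex.map θ, stdSimplex.continuous_map θ⟩

theorem SingularSimplex.reindex_reindex {X : Type*} [TopologicalSpace X] {l m n : ℕ}
    (σ : SingularSimplex X n) (θ : Fin (m + 1) → Fin (n + 1)) (η : Fin (l + 1) → Fin (m + 1)) :
    SingularSimplex.reindex (SingularSimplex.reindex σ θ) η =
      SingularSimplex.reindex σ (θ ∘ η) := by
  ext x
  simp [SingularSimplex.reindex, stdSimplex.map_comp_apply]

/-- Singular `n`-cochains with values in `K`. -/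
abbrev SingularCochain (K : Type*) (X : Type*) [TopologicalSpace X] (n : ℕ) :=
  SingularSimplex X n → K

/-- The singular coboundary `(δ f)(σ) = ∑ i, (-1)^i f(σ ∘ δ^i)`, with `δ^i` the inclusion of the
face opposite to the vertex `i`. -/
def singularCoboundary (K : Type*) [Field K] (X : Type*) [TopologicalSpace X] (n : ℕ) :
    SingularCochain K X n →ₗ[K] SingularCochain K X (n + 1) where
  toFun f σ := ∑ i : Fin (n + 2), (-1) ^ (i : ℕ) * f (SingularSimplex.reindex σ i.succAbove)
  map_add' f g := by
    funext σ
    simp [mul_add, Finset.sum_add_distrib]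
  map_smul' c f := by
    funext σ
    simp only [Pi.smul_apply, smul_eq_mul, RingHom.id_apply, Finset.mul_sum]
    exact Finset.sum_congr rfl fun i _ => by ring

theorem singularCoboundary_comp (K : Type*) [Field K] (X : Type*) [TopologicalSpace X] (n : ℕ)
    (f : SingularCochain K X n) :
    singularCoboundary K X (n + 1) (singularCoboundary K X n f) = 0 := by
  funext σ
  simp only [singularCoboundary, LinearMap.coe_mk, AddHom.coe_mk, Finset.mul_sum,
    SingularSimplex.reindex_reindex, Pi.zero_apply]
  rw [← Finset.sum_product', Finset.univ_product_univ]
  refine Finset.sum_involution (fun x _ => (x.1.succAbove x.2, x.2.predAbove x.1)) ?_ ?_ ?_ ?_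
  · rintro ⟨i, j⟩ -
    have h1 : (i.succAbove j).succAbove ∘ (j.predAbove i).succAbove
        = i.succAbove ∘ j.succAbove := by
      funext k
      simp [Fin.succAbove_succAbove_succAbove_predAbove]
    simp only [h1]
    have h2 := Fin.neg_one_pow_succAbove_add_predAbove (R := K) i j
    simp only [← mul_assoc, ← pow_add, h2]
    ring
  · rintro ⟨i, j⟩ - - h
    exact Fin.succAbove_ne i j (congrArg Prod.fst h)
  · intros
    exact Finset.mem_univ _
  · rintro ⟨i, j⟩ -
    ext <;> simp [Fin.succAbove_succAbove_predAbove, Fin.predAbove_predAbove_succAbove]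

/-- Singular cohomology `H^n(X, K)`. -/
abbrev SingularCohomology (K : Type*) [Field K] (X : Type*) [TopologicalSpace X] (n : ℕ) :=
  GradedCohomology K (SingularCochain K X) (singularCoboundary K X) n

/-- The cochain map induced by a continuous map. -/
def singularCochainMap (K : Type*) [Field K] {X Y : Type*} [TopologicalSpace X]
    [TopologicalSpace Y] (φ : C(X, Y)) (n : ℕ) :
    SingularCochain K Y n →ₗ[K] SingularCochain K X n where
  toFun f σ := f (φ.comp σ)
  map_add' _ _ := rfl
  map_smul' _ _ := rfl

theorem singularCochainMap_coboundary (K : Type*) [Field K] {X Y : Type*} [TopologicalSpace X]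
    [TopologicalSpace Y] (φ : C(X, Y)) (n : ℕ) (f : SingularCochain K Y n) :
    singularCochainMap K φ (n + 1) (singularCoboundary K Y n f) =
      singularCoboundary K X n (singularCochainMap K φ n f) := rfl

/-- The map `φ^* : H^n(Y, K) → H^n(X, K)` induced by a continuous map `φ : X → Y`. -/
def singularCohomologyMap (K : Type*) [Field K] {X Y : Type*} [TopologicalSpace X]
    [TopologicalSpace Y] (φ : C(X, Y)) (n : ℕ) :
    SingularCohomology K Y n →ₗ[K] SingularCohomology K X n :=
  Submodule.mapQ _ _
    ((singularCochainMap K φ n).restrict (p := LinearMap.ker (singularCoboundary K Y n))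
      (q := LinearMap.ker (singularCoboundary K X n)) (by
        intro f hf
        rw [LinearMap.mem_ker] at hf ⊢
        rw [← singularCochainMap_coboundary, hf, map_zero]))
    (by
      rintro ⟨f, hf⟩ hb
      cases n with
      | zero =>
        have h0 : f = 0 := by simpa [Submodule.submoduleOf, gradedBoundaries] using hb
        subst h0
        exact Submodule.zero_mem _
      | succ n =>
        obtain ⟨g, hg⟩ := hb
        exact ⟨singularCochainMap K φ n g, by
          rw [← singularCochainMap_coboundary, hg]; rfl⟩)

/-- The inclusion of the first `p + 1` vertices. -/
def frontVertices {p q n : ℕ} (h : p + q = n) (i : Fin (p + 1)) : Fin (n + 1) :=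
  ⟨i, by omega⟩

/-- The inclusion of the last `q + 1` vertices. -/
def backVertices {p q n : ℕ} (h : p + q = n) (i : Fin (q + 1)) : Fin (n + 1) :=
  ⟨p + i, by omega⟩

/-- The cup product of singular cochains: `(f ∪ g)(σ)` is `f` of the front `p`-face of `σ`
times `g` of the back `q`-face of `σ`. -/
def cochainCup (K : Type*) [Field K] (X : Type*) [TopologicalSpace X] {p q n : ℕ}
    (h : p + q = n) :
    SingularCochain K X p →ₗ[K] SingularCochain K X q →ₗ[K] SingularCochain K X n :=
  LinearMap.mk₂ K
    (fun f g σ => f (SingularSimplex.reindex σ (frontVertices h)) *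
      g (SingularSimplex.reindex σ (backVertices h)))
    (fun _ _ _ => by funext σ; simp [add_mul])
    (fun _ _ _ => by funext σ; simp [mul_assoc])
    (fun _ _ _ => by funext σ; simp [mul_add])
    (fun _ _ _ => by funext σ; simp [mul_left_comm])

theorem cochainCup_apply (K : Type*) [Field K] (X : Type*) [TopologicalSpace X] {p q n : ℕ}
    (h : p + q = n) (f : SingularCochain K X p) (g : SingularCochain K X q)
    (σ : SingularSimplex X n) :
    cochainCup K X h f g σ = f (SingularSimplex.reindex σ (frontVertices h)) *
      g (SingularSimplex.reindex σ (backVertices h)) := rfl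

/-- The Leibniz rule. -/
theorem singularCoboundary_cochainCup (K : Type*) [Field K] (X : Type*) [TopologicalSpace X]
    {p q n : ℕ} (h : p + q = n) (f : SingularCochain K X p) (g : SingularCochain K X q) :
    singularCoboundary K X n (cochainCup K X h f g) =
      cochainCup K X (show p + 1 + q = n + 1 by omega) (singularCoboundary K X p f) g +
      (-1 : K) ^ p •
        cochainCup K X (show p + (q + 1) = n + 1 by omega) f (singularCoboundary K X q g) := by
  subst h
  funext σ
  simp only [Pi.add_apply, Pi.smul_apply, smul_eq_mul, cochainCup_apply, singularCoboundary,
    LinearMap.coe_mk, AddHom.coe_mk, SingularSimplex.reindex_reindex]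
  set φ : ℕ → K := fun i => (-1) ^ i *
    f (SingularSimplex.reindex σ fun k : Fin (p + 1) =>
      (⟨if (k : ℕ) < i then (k : ℕ) else (k : ℕ) + 1, by split <;> omega⟩ : Fin (p + q + 1 + 1))) with hφ
  set B : K := g (SingularSimplex.reindex σ
    (backVertices (show p + 1 + q = p + q + 1 by omega))) with hB
  set A : K := f (SingularSimplex.reindex σ
    (frontVertices (show p + (q + 1) = p + q + 1 by omega))) with hA
  set ψ : ℕ → K := fun j => (-1) ^ j *
    g (SingularSimplex.reindex σ fun k : Fin (q + 1) =>
      (⟨p + (if (k : ℕ) < j then (k : ℕ) else (k : ℕ) + 1), by split <;> omega⟩ :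
        Fin (p + q + 1 + 1))) with hψ
  have hfront : ∀ i : Fin (p + 2), (-1 : K) ^ (i : ℕ) * f (SingularSimplex.reindex σ
      (frontVertices (show p + 1 + q = p + q + 1 by omega) ∘ i.succAbove)) = φ i := by
    intro i
    simp only [hφ]
    congr 3
    funext k
    ext
    simp only [frontVertices, Function.comp_apply, Fin.succAbove, Fin.lt_def, Fin.val_castSucc]
    split <;> simp
  have hback : ∀ j : Fin (q + 2), (-1 : K) ^ (j : ℕ) * g (SingularSimplex.reindex σ
      (backVertices (show p + (q + 1) = p + q + 1 by omega) ∘ j.succAbove)) = ψ j := by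
    intro j
    simp only [hψ]
    congr 3
    funext k
    ext
    simp only [backVertices, Function.comp_apply, Fin.succAbove, Fin.lt_def, Fin.val_castSucc]
    split <;> simp
  have hlow : ∀ i : ℕ, ∀ hi : i < p + q + 2, i ≤ p →
      (-1 : K) ^ i * (f (SingularSimplex.reindex σ
        ((⟨i, hi⟩ : Fin (p + q + 2)).succAbove ∘ frontVertices rfl)) *
        g (SingularSimplex.reindex σ
          ((⟨i, hi⟩ : Fin (p + q + 2)).succAbove ∘ backVertices rfl))) = φ i * B := by
    intro i hi hip
    rw [← mul_assoc]
    simp only [hφ, hB]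
    congr 3
    · congr 1
      funext k
      ext
      simp only [frontVertices, Function.comp_apply, Fin.succAbove, Fin.lt_def, Fin.val_castSucc]
      split <;> simp
    · funext k
      ext
      simp only [backVertices, Function.comp_apply, Fin.succAbove, Fin.lt_def, Fin.val_castSucc]
      rw [if_neg (by omega)]
      simp only [Fin.val_succ]
      omega
  have hhigh : ∀ j : ℕ, ∀ hi : p + (j + 1) < p + q + 2,
      (-1 : K) ^ (p + (j + 1)) * (f (SingularSimplex.reindex σ
        ((⟨p + (j + 1), hi⟩ : Fin (p + q + 2)).succAbove ∘ frontVertices rfl)) *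
        g (SingularSimplex.reindex σ
          ((⟨p + (j + 1), hi⟩ : Fin (p + q + 2)).succAbove ∘ backVertices rfl))) =
        (-1) ^ p * (A * ψ (j + 1)) := by
    intro j hi
    have e1 : (⟨p + (j + 1), hi⟩ : Fin (p + q + 2)).succAbove ∘
        frontVertices (rfl : p + q = p + q) =
        frontVertices (show p + (q + 1) = p + q + 1 by omega) := by
      funext k
      ext
      simp only [frontVertices, Function.comp_apply, Fin.succAbove, Fin.lt_def, Fin.val_castSucc]
      rw [if_pos (by omega)]
      rfl
    have e2 : (⟨p + (j + 1), hi⟩ : Fin (p + q + 2)).succAbove ∘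
        backVertices (rfl : p + q = p + q) = fun k : Fin (q + 1) =>
        (⟨p + (if (k : ℕ) < j + 1 then (k : ℕ) else (k : ℕ) + 1), by split <;> omega⟩ :
          Fin (p + q + 1 + 1)) := by
      funext k
      ext
      simp only [backVertices, Function.comp_apply, Fin.succAbove, Fin.lt_def, Fin.val_castSucc]
      by_cases hk : (k : ℕ) < j + 1
      · rw [if_pos (by omega), if_pos hk]
        rfl
      · rw [if_neg (by omega), if_neg hk]
        simp [add_assoc]
    rw [e1, e2]
    simp only [hψ, hA, pow_add]
    ring
  have hcancel : φ (p + 1) * B + (-1) ^ p * (A * ψ 0) = 0 := by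
    have e1 : φ (p + 1) = (-1) ^ (p + 1) * A := by
      simp only [hφ, hA]
      congr 3
      funext k
      ext
      simp only [frontVertices]
      rw [if_pos k.2]
    have e2 : ψ 0 = B := by
      simp only [hψ, hB, pow_zero, one_mul]
      congr 2
      funext k
      ext
      simp [backVertices]
      omega
    rw [e1, e2]
    ring
  simp only [hfront, hback]
  set T : ℕ → K := fun i => if hi : i < p + q + 2 then
      (-1 : K) ^ i * (f (SingularSimplex.reindex σ
        ((⟨i, hi⟩ : Fin (p + q + 2)).succAbove ∘ frontVertices rfl)) *
        g (SingularSimplex.reindex σ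
          ((⟨i, hi⟩ : Fin (p + q + 2)).succAbove ∘ backVertices rfl))) else 0 with hT
  have hsum : (∑ i : Fin (p + q + 2), (-1 : K) ^ (i : ℕ) * (f (SingularSimplex.reindex σ
        (i.succAbove ∘ frontVertices rfl)) *
        g (SingularSimplex.reindex σ (i.succAbove ∘ backVertices rfl)))) =
      ∑ i ∈ Finset.range (p + 1 + (q + 1)), T i := by
    rw [show p + 1 + (q + 1) = p + q + 2 by omega, Finset.sum_range]
    refine Finset.sum_congr rfl fun i _ => ?_
    simp only [hT, dif_pos i.2]
  rw [hsum, Finset.sum_range_add, Fin.sum_univ_eq_sum_range (fun i => φ i) (p + 2),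
    Fin.sum_univ_eq_sum_range (fun i => ψ i) (q + 2), Finset.sum_range_succ _ (p + 1),
    Finset.sum_range_succ' _ (q + 1)]
  have s1 : ∑ i ∈ Finset.range (p + 1), T i = (∑ i ∈ Finset.range (p + 1), φ i) * B := by
    rw [Finset.sum_mul]
    refine Finset.sum_congr rfl fun i hi => ?_
    have hi' := Finset.mem_range.1 hi
    simp only [hT]
    rw [dif_pos (by omega), hlow i (by omega) (by omega)]
  have s2 : ∑ j ∈ Finset.range (q + 1), T (p + 1 + j) =
      (-1) ^ p * (A * ∑ j ∈ Finset.range (q + 1), ψ (j + 1)) := by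
    rw [Finset.mul_sum, Finset.mul_sum]
    refine Finset.sum_congr rfl fun j hj => ?_
    have hj' := Finset.mem_range.1 hj
    rw [show p + 1 + j = p + (j + 1) by omega]
    simp only [hT]
    rw [dif_pos (by omega), hhigh j (by omega)]
  rw [s1, s2]
  linear_combination -hcancel

/-- The product of a cocycle with a cocycle, as a bilinear map to cohomology. -/
def cocycleCup (K : Type*) [Field K] (X : Type*) [TopologicalSpace X] {p q n : ℕ}
    (h : p + q = n) :
    LinearMap.ker (singularCoboundary K X p) →ₗ[K] LinearMap.ker (singularCoboundary K X q) →ₗ[K]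
      SingularCohomology K X n :=
  LinearMap.mk₂ K
    (fun f g => Submodule.Quotient.mk ⟨cochainCup K X h f.1 g.1, by
      rw [LinearMap.mem_ker, singularCoboundary_cochainCup, LinearMap.mem_ker.1 f.2,
        LinearMap.mem_ker.1 g.2]
      simp⟩)
    (fun f f' g => by
      rw [← Submodule.Quotient.mk_add]
      exact congrArg _ (Subtype.ext (by simp)))
    (fun c f g => by
      rw [← Submodule.Quotient.mk_smul]
      exact congrArg _ (Subtype.ext (by simp)))
    (fun f g g' => by
      rw [← Submodule.Quotient.mk_add]
      exact congrArg _ (Subtype.ext (by simp)))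
    (fun c f g => by
      rw [← Submodule.Quotient.mk_smul]
      exact congrArg _ (Subtype.ext (by simp)))

theorem cocycleCup_left_boundary (K : Type*) [Field K] (X : Type*) [TopologicalSpace X]
    {p q n : ℕ} (h : p + q = n) (f : LinearMap.ker (singularCoboundary K X p))
    (g : LinearMap.ker (singularCoboundary K X q))
    (hf : f.1 ∈ gradedBoundaries K (SingularCochain K X) (singularCoboundary K X) p) :
    cocycleCup K X h f g = 0 := by
  refine (Submodule.Quotient.mk_eq_zero _).2 ?_
  change cochainCup K X h f.1 g.1 ∈
    gradedBoundaries K (SingularCochain K X) (singularCoboundary K X) n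
  cases p with
  | zero =>
    have h0 : f.1 = 0 := hf
    rw [h0]
    simp
  | succ p =>
    obtain ⟨e, he⟩ := hf
    obtain _ | n := n
    · omega
    refine ⟨cochainCup K X (show p + q = n by omega) e g.1, ?_⟩
    rw [singularCoboundary_cochainCup, he, LinearMap.mem_ker.1 g.2]
    simp

theorem cocycleCup_right_boundary (K : Type*) [Field K] (X : Type*) [TopologicalSpace X]
    {p q n : ℕ} (h : p + q = n) (f : LinearMap.ker (singularCoboundary K X p))
    (g : LinearMap.ker (singularCoboundary K X q))
    (hg : g.1 ∈ gradedBoundaries K (SingularCochain K X) (singularCoboundary K X) q) :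
    cocycleCup K X h f g = 0 := by
  refine (Submodule.Quotient.mk_eq_zero _).2 ?_
  change cochainCup K X h f.1 g.1 ∈
    gradedBoundaries K (SingularCochain K X) (singularCoboundary K X) n
  cases q with
  | zero =>
    have h0 : g.1 = 0 := hg
    rw [h0]
    simp
  | succ q =>
    obtain ⟨e, he⟩ := hg
    obtain _ | n := n
    · omega
    refine ⟨(-1 : K) ^ p • cochainCup K X (show p + q = n by omega) f.1 e, ?_⟩
    rw [map_smul, singularCoboundary_cochainCup, he, LinearMap.mem_ker.1 f.2]
    simp [smul_smul, ← mul_pow]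

/-- The cup product `H^p(X, K) × H^q(X, K) → H^(p+q)(X, K)`. -/
def cohomologyCup (K : Type*) [Field K] (X : Type*) [TopologicalSpace X] {p q n : ℕ}
    (h : p + q = n) :
    SingularCohomology K X p →ₗ[K] SingularCohomology K X q →ₗ[K] SingularCohomology K X n :=
  Submodule.liftQ _
    (LinearMap.flip (Submodule.liftQ _ (cocycleCup K X h).flip (by
      intro g hg
      refine LinearMap.ext fun f => ?_
      exact cocycleCup_right_boundary K X h f g hg)))
    (by
      intro f hf
      refine LinearMap.ext fun y => ?_
      obtain ⟨g, rfl⟩ := Submodule.Quotient.mk_surjective _ y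
      exact cocycleCup_left_boundary K X h f g hf)

/-- Right multiplication `μ_α : H^i(X, K) → H^(i+1)(X, K)`, `x ↦ x ∪ α`, by a class `α` of
degree one. -/
def rightMul (K : Type*) [Field K] (X : Type*) [TopologicalSpace X]
    (α : SingularCohomology K X 1) (i : ℕ) :
    SingularCohomology K X i →ₗ[K] SingularCohomology K X (i + 1) :=
  (cohomologyCup K X (rfl : i + 1 = i + 1)).flip α

/-- The resonance variety `R^i_m(X, K)`: the classes `α ∈ H^1(X, K)` for which the degree `i`
cohomology of the complex `(H^•(X, K), μ_α)` has dimension at least `m`. The dimension is a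
cardinal, so an infinite dimension exceeds every `m`. -/
def resonanceVariety (K : Type*) [Field K] (X : Type*) [TopologicalSpace X] (i m : ℕ) :
    Set (SingularCohomology K X 1) :=
  {α | (m : Cardinal) ≤
    Module.rank K (GradedCohomology K (SingularCohomology K X) (rightMul K X α) i)}

end

/-! The proof is a transfer argument on singular cochains. A simplex is contractible, so every
singular simplex of `M` lifts to `F`, and its lifts form a single `C`-orbit. Hence `p^*` identifies
the cochains of `M` with the `C`-invariant cochains of `F`. Since `|C|` is invertible in `K`,
averaging over `C` shows that `p^*` is injective on cohomology in every degree
(`singularCohomologyMap_injective`) and that its image contains every invariant class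
(`exists_singularCohomologyMap_eq`). A trivial action in degrees at most `q` thus gives bijectivity
there, while injectivity in degree `q + 1` costs nothing.

As `p^*` respects cup products, it is a morphism from `(H^•(M), μ_α)` to `(H^•(F), μ_{p^*α})`. For
`i ≤ q` it is bijective in degrees at most `i` and injective in degree `i + 1`, which suffices to
preserve cohomology in degree `i` (`natCast_le_rank_gradedCohomology_iff`). -/

/-- A continuous map from a contractible space lifts through a surjective covering map. -/
theorem IsCoveringMap.exists_lift_of_contractibleSpace {A E X : Type*} [TopologicalSpace A]
    [TopologicalSpace E] [TopologicalSpace X] [ContractibleSpace A] {p : E → X}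
    (cov : IsCoveringMap p) (hs : Function.Surjective p) (f : C(A, X)) :
    ∃ g : C(A, E), ∀ a, p (g a) = f a := by
  obtain ⟨a₀, ⟨H⟩⟩ := id_nullhomotopic A
  -- `H` contracts `A` to `a₀`. Run backwards and composed with `f`, it starts at a constant map,
  -- which lifts to the constant `e`, and ends at `f`; the lifted homotopy at time `1` is the
  -- required lift.
  obtain ⟨e, he⟩ := hs (f a₀)
  have h0 : ∀ a, (f.comp H.symm.toContinuousMap) (0, a) = p (ContinuousMap.const A e a) := by
    intro a
    simpa using he.symm
  refine ⟨(cov.liftHomotopy (f.comp H.symm.toContinuousMap) (ContinuousMap.const A e) h0).comp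
    ((ContinuousMap.const A 1).prodMk (ContinuousMap.id A)), fun a => ?_⟩
  have h := congrFun (cov.liftHomotopy_lifts (f.comp H.symm.toContinuousMap)
    (ContinuousMap.const A e) h0) (1, a)
  refine h.trans ?_
  simp

instance stdSimplex.instContractibleSpace (n : ℕ) :
    ContractibleSpace (stdSimplex ℝ (Fin (n + 1))) :=
  (convex_stdSimplex ℝ (Fin (n + 1))).contractibleSpace
    (isPathConnected_stdSimplex (Fin (n + 1))).nonempty

theorem singularCohomologyMap_mk (K : Type*) [Field K] {X Y : Type*} [TopologicalSpace X]
    [TopologicalSpace Y] (φ : C(X, Y)) (n : ℕ) (f : SingularCochain K Y n)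
    (hf : f ∈ LinearMap.ker (singularCoboundary K Y n)) :
    singularCohomologyMap K φ n (Submodule.Quotient.mk ⟨f, hf⟩) =
      Submodule.Quotient.mk ⟨singularCochainMap K φ n f, by
        rw [LinearMap.mem_ker, ← singularCochainMap_coboundary, LinearMap.mem_ker.1 hf,
          map_zero]⟩ := rfl

/-! ### Cochains of a Galois cover and the transfer -/

namespace IsQuotientCoveringMap

variable {M F C : Type*} [TopologicalSpace M] [TopologicalSpace F] [Group C] [MulAction C F]
  {p : C(F, M)}

/-- The deck transformation given by `c`. -/
def deck (hp : IsQuotientCoveringMap p C) (c : C) : C(F, F) :=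
  ⟨fun y => c • y, hp.continuous_const_smul c⟩

theorem comp_deck (hp : IsQuotientCoveringMap p C) (c : C) : p.comp (hp.deck c) = p :=
  ContinuousMap.ext fun _ => hp.map_smul c

theorem deck_comp_deck (hp : IsQuotientCoveringMap p C) (c c' : C) :
    (hp.deck c).comp (hp.deck c') = hp.deck (c * c') :=
  ContinuousMap.ext fun y => (mul_smul c c' y).symm

theorem exists_simplex_lift (hp : IsQuotientCoveringMap p C) {n : ℕ} (σ : SingularSimplex M n) :
    ∃ τ : SingularSimplex F n, p.comp τ = σ := by
  obtain ⟨τ, hτ⟩ := hp.isCoveringMap.exists_lift_of_contractibleSpace hp.surjective σ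
  exact ⟨τ, ContinuousMap.ext hτ⟩

/-- Fibres are orbits, so a deck transformation makes the two lifts agree at one point; lifts on a
connected simplex that agree at one point are equal. -/
theorem exists_deck_comp_eq (hp : IsQuotientCoveringMap p C)
    {n : ℕ} {τ τ' : SingularSimplex F n} (h : p.comp τ = p.comp τ') :
    ∃ c : C, (hp.deck c).comp τ' = τ := by
  obtain ⟨a⟩ : Nonempty (stdSimplex ℝ (Fin (n + 1))) := inferInstance
  obtain ⟨c, hc⟩ := hp.apply_eq_iff_mem_orbit.1 (DFunLike.congr_fun h a)
  refine ⟨c, DFunLike.coe_injective (hp.isCoveringMap.eq_of_comp_eq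
    (ContinuousMap.continuous _) τ.continuous ?_ a hc)⟩
  funext x
  exact (hp.map_smul c).trans (DFunLike.congr_fun h x).symm

variable (K : Type*) [Field K]

theorem singularCochainMap_injective (hp : IsQuotientCoveringMap p C) (n : ℕ) :
    Function.Injective (singularCochainMap K p n) := by
  intro f g h
  funext σ
  obtain ⟨τ, rfl⟩ := hp.exists_simplex_lift σ
  exact congrFun h τ

/-- The cochains that are invariant under deck transformations descend to the base. -/
theorem exists_singularCochainMap_eq (hp : IsQuotientCoveringMap p C)
    {n : ℕ} {g : SingularCochain K F n}
    (hg : ∀ c, singularCochainMap K (hp.deck c) n g = g) :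
    ∃ f, singularCochainMap K p n f = g := by
  choose s hs using fun σ : SingularSimplex M n => hp.exists_simplex_lift σ
  refine ⟨fun σ => g (s σ), funext fun τ => ?_⟩
  obtain ⟨c, hc⟩ := hp.exists_deck_comp_eq (hs (p.comp τ))
  change g (s (p.comp τ)) = g τ
  rw [← hc]
  exact congrFun (hg c) τ

/-- The cochain `f` is the transfer of `g`: the sum over the group is invariant, hence descends. -/
theorem exists_singularCochainMap_eq_sum (hp : IsQuotientCoveringMap p C)
    [Fintype C] {n : ℕ} (g : SingularCochain K F n) :
    ∃ f, singularCochainMap K p n f = ∑ c, singularCochainMap K (hp.deck c) n g := by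
  refine hp.exists_singularCochainMap_eq K fun c => ?_
  rw [map_sum]
  -- Pullback is contravariant, so a further pullback along `c` permutes the summands by right
  -- translation.
  refine Fintype.sum_equiv (Equiv.mulRight c) _ _ fun c' => ?_
  funext τ
  change g ((hp.deck c').comp ((hp.deck c).comp τ)) = g ((hp.deck (c' * c)).comp τ)
  rw [← deck_comp_deck]
  rfl

theorem singularCochainMap_deck_comp (hp : IsQuotientCoveringMap p C)
    (c : C) {n : ℕ} (f : SingularCochain K M n) :
    singularCochainMap K (hp.deck c) n (singularCochainMap K p n f) =
      singularCochainMap K p n f := by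
  funext τ
  change f ((p.comp (hp.deck c)).comp τ) = f (p.comp τ)
  rw [comp_deck]

/-- The projection of a finite Galois cover is injective on cohomology in characteristic zero. -/
theorem singularCohomologyMap_injective [CharZero K] [Finite C]
    (hp : IsQuotientCoveringMap p C) (n : ℕ) :
    Function.Injective (singularCohomologyMap K p n) := by
  have := Fintype.ofFinite C
  have hC : (Fintype.card C : K) ≠ 0 := Nat.cast_ne_zero.2 Fintype.card_ne_zero
  rw [injective_iff_map_eq_zero]
  intro x hx
  obtain ⟨⟨f, hf⟩, rfl⟩ := Submodule.Quotient.mk_surjective _ x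
  refine (Submodule.Quotient.mk_eq_zero _).2 ?_
  rw [singularCohomologyMap_mk, Submodule.Quotient.mk_eq_zero] at hx
  replace hx : singularCochainMap K p n f ∈
    gradedBoundaries K (SingularCochain K F) (singularCoboundary K F) n := hx
  change f ∈ gradedBoundaries K (SingularCochain K M) (singularCoboundary K M) n
  cases n with
  | zero =>
    have h0 : singularCochainMap K p 0 f = 0 := hx
    have h1 : f = 0 := hp.singularCochainMap_injective K 0 (h0.trans (map_zero _).symm)
    rw [h1]
    exact Submodule.zero_mem _
  | succ n =>
    obtain ⟨g, hg⟩ := hx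
    obtain ⟨h, hh⟩ := hp.exists_singularCochainMap_eq_sum K g
    -- With `p^* f = δ g`, the average of the translates of `g` still has coboundary `p^* f`,
    -- because `p^* f` is invariant.
    refine ⟨(Fintype.card C : K)⁻¹ • h, hp.singularCochainMap_injective K _ ?_⟩
    rw [singularCochainMap_coboundary, map_smul, map_smul, hh, map_sum]
    simp only [← singularCochainMap_coboundary, hg, singularCochainMap_deck_comp,
      Finset.sum_const, Finset.card_univ]
    rw [← Nat.cast_smul_eq_nsmul K, inv_smul_smul₀ hC]

/-- In characteristic zero, every invariant cohomology class of a finite Galois cover is pulled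
back from the base. -/
theorem exists_singularCohomologyMap_eq [CharZero K] [Finite C]
    (hp : IsQuotientCoveringMap p C) {n : ℕ} {x : SingularCohomology K F n}
    (hx : ∀ c, singularCohomologyMap K (hp.deck c) n x = x) :
    ∃ y, singularCohomologyMap K p n y = x := by
  have := Fintype.ofFinite C
  have hC : (Fintype.card C : K) ≠ 0 := Nat.cast_ne_zero.2 Fintype.card_ne_zero
  obtain ⟨⟨g, hg⟩, rfl⟩ := Submodule.Quotient.mk_surjective _ x
  obtain ⟨h, hh⟩ := hp.exists_singularCochainMap_eq_sum K g
  have hcocycle : h ∈ LinearMap.ker (singularCoboundary K M n) := by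
    refine hp.singularCochainMap_injective K _ ?_
    rw [singularCochainMap_coboundary, hh, map_sum, map_zero]
    simp [← singularCochainMap_coboundary, LinearMap.mem_ker.1 hg]
  have key : singularCohomologyMap K p n (Submodule.Quotient.mk ⟨h, hcocycle⟩) =
      ∑ c, singularCohomologyMap K (hp.deck c) n (Submodule.Quotient.mk ⟨g, hg⟩) := by
    change Submodule.mkQ _ _ = ∑ c, Submodule.mkQ _ _
    rw [← map_sum]
    refine congrArg _ (Subtype.ext ?_)
    rw [AddSubmonoidClass.coe_finsetSum]
    exact hh
  -- By invariance of the class, the sum of its translates is `|C|` times itself.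
  refine ⟨(Fintype.card C : K)⁻¹ • Submodule.Quotient.mk ⟨h, hcocycle⟩, ?_⟩
  rw [map_smul, key]
  simp only [hx, Finset.sum_const, Finset.card_univ]
  rw [← Nat.cast_smul_eq_nsmul K, inv_smul_smul₀ hC]

end IsQuotientCoveringMap

/-! ### Cup products and resonance -/

theorem singularCohomologyMap_cohomologyCup (K : Type*) [Field K] {X Y : Type*}
    [TopologicalSpace X] [TopologicalSpace Y] (φ : C(X, Y)) {p q n : ℕ} (h : p + q = n)
    (x : SingularCohomology K Y p) (y : SingularCohomology K Y q) :
    singularCohomologyMap K φ n (cohomologyCup K Y h x y) =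
      cohomologyCup K X h (singularCohomologyMap K φ p x) (singularCohomologyMap K φ q y) := by
  obtain ⟨f, rfl⟩ := Submodule.Quotient.mk_surjective _ x
  obtain ⟨g, rfl⟩ := Submodule.Quotient.mk_surjective _ y
  rfl

/-- A morphism of cochain complexes that is bijective in degrees at most `n` and injective in
degree `n + 1` preserves the dimension of the cohomology in degree `n`. -/
theorem natCast_le_rank_gradedCohomology_iff {K : Type*} [Field K] {A B : ℕ → Type*}
    [∀ n, AddCommGroup (A n)] [∀ n, Module K (A n)] [∀ n, AddCommGroup (B n)]
    [∀ n, Module K (B n)] {d : ∀ n, A n →ₗ[K] A (n + 1)} {e : ∀ n, B n →ₗ[K] B (n + 1)}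
    (φ : ∀ n, A n →ₗ[K] B n) (hφ : ∀ n x, φ (n + 1) (d n x) = e n (φ n x)) {n : ℕ}
    (hbij : ∀ i ≤ n, Function.Bijective (φ i)) (hinj : Function.Injective (φ (n + 1))) (m : ℕ) :
    (m : Cardinal) ≤ Module.rank K (GradedCohomology K A d n) ↔
      (m : Cardinal) ≤ Module.rank K (GradedCohomology K B e n) := by
  have hker : (LinearMap.ker (d n)).map (φ n) = LinearMap.ker (e n) := by
    ext y
    constructor
    · rintro ⟨x, hx, rfl⟩
      rw [LinearMap.mem_ker, ← hφ, LinearMap.mem_ker.1 hx, map_zero]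
    · intro hy
      obtain ⟨x, rfl⟩ := (hbij n le_rfl).2 y
      -- Injectivity in degree `n + 1` is what makes the preimage of a cocycle a cocycle.
      refine ⟨x, hinj ?_, rfl⟩
      rw [hφ, LinearMap.mem_ker.1 hy, map_zero]
  have hbd : (gradedBoundaries K A d n).map (φ n) = gradedBoundaries K B e n := by
    cases n with
    | zero => exact Submodule.map_bot _
    | succ n =>
      change (LinearMap.range (d n)).map (φ (n + 1)) = LinearMap.range (e n)
      have hcomm : (φ (n + 1)).comp (d n) = (e n).comp (φ n) := LinearMap.ext (hφ n)
      rw [← LinearMap.range_comp, hcomm, LinearMap.range_comp_of_range_eq_top]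
      exact LinearMap.range_eq_top.2 (hbij n n.le_succ).2
  let E : LinearMap.ker (d n) ≃ₗ[K] LinearMap.ker (e n) :=
    (Submodule.equivMapOfInjective (φ n) (hbij n le_rfl).1 _).trans (LinearEquiv.ofEq _ _ hker)
  have hE : ∀ x, (E x : B n) = φ n x := fun _ => rfl
  have hsub : ((gradedBoundaries K A d n).submoduleOf (LinearMap.ker (d n))).map
      (E : LinearMap.ker (d n) →ₗ[K] LinearMap.ker (e n)) =
      (gradedBoundaries K B e n).submoduleOf (LinearMap.ker (e n)) := by
    ext y
    constructor
    · rintro ⟨x, hx, rfl⟩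
      change (E x : B n) ∈ gradedBoundaries K B e n
      rw [hE, ← hbd]
      exact ⟨x, hx, rfl⟩
    · intro hy
      refine ⟨E.symm y, ?_, E.apply_symm_apply y⟩
      replace hy : (y : B n) ∈ (gradedBoundaries K A d n).map (φ n) := by
        rw [hbd]
        exact hy
      obtain ⟨x, hx, hxy⟩ := hy
      have : x = E.symm y := (hbij n le_rfl).1 (by rw [hxy, ← hE, E.apply_symm_apply])
      change (E.symm y : A n) ∈ gradedBoundaries K A d n
      rwa [← this]
  -- The two ranks may live in different universes, so they are compared after lifting; bounds by a
  -- natural number are unaffected.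
  have h := (Submodule.Quotient.equiv _ _ E hsub).lift_rank_eq
  rw [← Cardinal.nat_le_lift_iff, h, Cardinal.nat_le_lift_iff]

theorem corollary2p2 {K : Type*} [Field K] [CharZero K]
    {M F : Type*} [TopologicalSpace M] [T2Space M] [ConnectedSpace M]
    [Topology.CWComplex (Set.univ : Set M)]
    (hskel : ∀ n ≤ 1, Finite (Topology.CWComplex.cell (Set.univ : Set M) n))
    [TopologicalSpace F] [ConnectedSpace F]
    {C : Type*} [Group C] [Finite C] [MulAction C F]
    (p : C(F, M)) (hp : IsQuotientCoveringMap p C)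
    (q : ℕ) (hq : 1 ≤ q)
    (htriv : ∀ i ≤ q, ∀ c : C, ∀ x : SingularCohomology K F i,
      singularCohomologyMap K ⟨fun y : F => c • y, hp.continuous_const_smul c⟩ i x = x) :
    (∀ i ≤ q, Function.Bijective (singularCohomologyMap K p i)) ∧
    Function.Injective (singularCohomologyMap K p (q + 1)) ∧
    (∀ i ≤ q, ∀ m : ℕ, 0 < m →
      singularCohomologyMap K p 1 '' resonanceVariety K M i m = resonanceVariety K F i m) := by
  have hbij : ∀ i ≤ q, Function.Bijective (singularCohomologyMap K p i) := fun i hi =>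
    ⟨hp.singularCohomologyMap_injective K i, fun x =>
      hp.exists_singularCohomologyMap_eq K fun c => htriv i hi c x⟩
  have hres : ∀ i ≤ q, ∀ m : ℕ, ∀ α, α ∈ resonanceVariety K M i m ↔
      singularCohomologyMap K p 1 α ∈ resonanceVariety K F i m := fun i hi m α =>
    natCast_le_rank_gradedCohomology_iff (singularCohomologyMap K p)
      (fun n x => singularCohomologyMap_cohomologyCup K p rfl x α)
      (fun j hj => hbij j (hj.trans hi)) (hp.singularCohomologyMap_injective K (i + 1)) m
  refine ⟨hbij, hp.singularCohomologyMap_injective K (q + 1), fun i hi m _ => ?_⟩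
  -- Surjectivity of `p^*` in degree `1`, available since `1 ≤ q`, turns the pointwise equivalence
  -- into an equality of images.
  rw [← Set.image_preimage_eq (resonanceVariety K F i m) (hbij 1 hq).2]
  exact congrArg _ (Set.ext fun α => hres i hi m α)
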